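/- **Theorem.** Let $(x_k)_{k\in\mathbb Z}$ be real numbers with $x_k<x_{k'}$ for $k<k'$ and $|x_k|\to\infty$ as $|k|\to\infty$, and let $(v_k)_{k\in\mathbb Z}$ be real random variables. Particle $P_k$ has mass $1$, initial position $x_k$ and initial velocity $v_k$. The particles follow the sticky rule: a clump (the set of all particles at a common position) of mass $m$ moves freely at constant velocity until it meets another clump; clumps that meet merge for ever, and mass and momentum are preserved, so that clumps of masses $m,m'$ and velocities $v,v'$ form a clump of mass $m+m'$ and velocity $\frac{mv+m'v'}{m+m'}$. Trajectories are continuous, and it is understood that the evolution exists for all times $t\ge 0$, all clumps being finite at every finite time. Define the potential $\psi:\mathbb Z\to\mathbb R$ by $\psi(0)=0$ and $\psi(k+1)-\psi(k)=-v_k$, and write $\psi$ also for its linear interpolation on $\mathbb R$. Suppose that for all integers $k<p<r$, almost surely $\frac{\psi(p)-\psi(k)}{p-k}\ne\frac{\psi(r)-\psi(p)}{r-p}$. Let $\mathbf E^+_\psi$ be the set of extremal superior times of $\psi$, that is, of those $a\in\mathbb R$ for which $(a,\psi(a))$ is an extreme point of the convex hull of the graph of $\psi$ and lies on the upper border of this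 hull. For $q\in\mathbb Z$ let $Z_q$ (the ultimate clump of $P_q$) be the set of indices of all particles that are in the same clump as $P_q$ after some finite time. Then, almost surely, the following holds for every such evolution with these initial data. 1. $\mathbf E^+_\psi\subset\mathbb Z$, and an integer $q$ belongs to $\mathbf E^+_\psi$ if and only if $q$ is the least element (left endpoint) of $Z_q$. 2. The ultimate clumps form a partition of $\mathbb Z$. The blocks $Z_q$, $q\in\mathbf E^+_\psi$, are pairwise disjoint for distinct $q$, and $\bigcup_{q\in\mathbf E^+_\psi}Z_q=\{k\in\mathbb Z:\ q\le k\text{ for some }q\in\mathbf E^+_\psi\}$. In particular $\mathbb Z=\bigcup_{q\in\mathbf E^+_\psi}Z_q$ if and only if $\mathbf E^+_\psi$ is not bounded below. The integers smaller than all elements of $\mathbf E^+_\psi$, if there are any, form exactly one further ultimate clump. 3. For every $k\in\mathbb Z$, particle $P_k$ never collides with a neighbour ($P_{k-1}$ or $P_{k+1}$) if and only if $k$ and $k+1$ both belong to $\mathbf E^+_\psi$. -/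

import Mathlib

open Set Filter Topology MeasureTheory

namespace StickyParticles

/-! ### The particle system -/

/-- The clump of particle `k` at time `t`: the indices of all particles that sit at the position
of particle `k` at time `t`. Every particle has mass `1`, so the mass of a clump is its number of
elements. -/
def clump (X : ℝ → ℤ → ℝ) (t : ℝ) (k : ℤ) : Set ℤ :=
  {j | X t j = X t k}

/-- `X t k` and `V t k` (for `t ≥ 0`) are the positions and velocities of unit-mass particles
started at the positions `x k` with the velocities `v k` and subject to the sticky rule: a clump
moves freely, at constant velocity, until it meets other clumps; clumps that meet form a new
clump for ever, and mass and momentum are preserved. -/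
structure IsStickyEvolution (x v : ℤ → ℝ) (X V : ℝ → ℤ → ℝ) : Prop where
  init_pos : ∀ k, X 0 k = x k
  init_vel : ∀ k, V 0 k = v k
  /-- trajectories are continuous -/
  continuousOn : ∀ k, ContinuousOn (fun t => X t k) (Ici 0)
  /-- particles that have met stay together -/
  sticky : ∀ s t i j, 0 ≤ s → s ≤ t → X s i = X s j → X t i = X t j
  /-- clumps have finite mass at every (finite) time -/
  clump_finite : ∀ t k, 0 ≤ t → (clump X t k).Finite
  /-- a clump that has met nobody between the times `s` and `t` has moved freely -/
  free : ∀ s t k, 0 ≤ s → s ≤ t → clump X t k = clump X s k →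
    X t k = X s k + (t - s) * V s k ∧ V t k = V s k
  /-- the momentum of a clump at time `t` is the total momentum that its particles had
  immediately before time `t` -/
  momentum : ∀ t k, 0 < t → ∀ᶠ s in 𝓝[<] t,
    ((clump X t k).ncard : ℝ) * V t k = ∑ᶠ j ∈ clump X t k, V s j

/-- The indices of all particles that end up in the same clump as particle `q` after a finite
time. -/
def ultimateClump (X : ℝ → ℤ → ℝ) (q : ℤ) : Set ℤ :=
  {j | ∃ t, 0 ≤ t ∧ j ∈ clump X t q}

/-- Particle `k` never collides with one of its two neighbours. -/
def NeverCollides (X : ℝ → ℤ → ℝ) (k : ℤ) : Prop :=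
  ∀ t, 0 ≤ t → X t k ≠ X t (k - 1) ∧ X t k ≠ X t (k + 1)

/-! ### The potential and its extremal superior times -/

/-- The initial potential at the integers: `ψ 0 = 0` and `ψ (k + 1) - ψ k = - v k`, see
`potential_zero` and `potential_succ_sub`. -/
noncomputable def potential (v : ℤ → ℝ) (k : ℤ) : ℝ :=
  ∑ i ∈ Finset.Ico k 0, v i - ∑ i ∈ Finset.Ico 0 k, v i

theorem potential_zero (v : ℤ → ℝ) : potential v 0 = 0 := by
  simp [potential]

theorem potential_succ_sub (v : ℤ → ℝ) (k : ℤ) :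
    potential v (k + 1) - potential v k = - v k := by
  unfold potential
  rcases le_or_gt 0 k with hk | hk
  · have h1 : Finset.Ico 0 (k + 1) = insert k (Finset.Ico 0 k) := by
      ext i; simp only [Finset.mem_Ico, Finset.mem_insert]; omega
    have h2 : Finset.Ico k 0 = ∅ := by
      ext i; simp only [Finset.mem_Ico, Finset.notMem_empty, iff_false]; omega
    have h3 : Finset.Ico (k + 1) 0 = ∅ := by
      ext i; simp only [Finset.mem_Ico, Finset.notMem_empty, iff_false]; omega
    rw [h1, h2, h3, Finset.sum_insert (by simp)]
    simp
  · have h1 : Finset.Ico k 0 = insert k (Finset.Ico (k + 1) 0) := by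
      ext i; simp only [Finset.mem_Ico, Finset.mem_insert]; omega
    have h2 : Finset.Ico 0 k = ∅ := by
      ext i; simp only [Finset.mem_Ico, Finset.notMem_empty, iff_false]; omega
    have h3 : Finset.Ico 0 (k + 1) = ∅ := by
      ext i; simp only [Finset.mem_Ico, Finset.notMem_empty, iff_false]; omega
    rw [h1, h2, h3, Finset.sum_insert (by simp)]
    simp

/-- The linear interpolation on `ℝ` of a function on the integers. -/
noncomputable def interpolate (ψ : ℤ → ℝ) (a : ℝ) : ℝ :=
  ψ ⌊a⌋ + Int.fract a * (ψ (⌊a⌋ + 1) - ψ ⌊a⌋)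

/-- The extremal superior times of `f : ℝ → ℝ`: the times `a` such that `(a, f a)` is an extremal
point of the convex hull of the graph of `f` and lies on the upper border of that hull. -/
def extremalSuperiorTimes (f : ℝ → ℝ) : Set ℝ :=
  {a | (a, f a) ∈ (convexHull ℝ {p : ℝ × ℝ | p.2 = f p.1}).extremePoints ℝ ∧
    ∀ y, (a, y) ∈ convexHull ℝ {p : ℝ × ℝ | p.2 = f p.1} → y ≤ f a}

/-- The particles `q` whose label is an extremal superior time of the interpolated potential. -/
noncomputable def extremalIndices (v : ℤ → ℝ) : Set ℤ :=
  {q | (q : ℝ) ∈ extremalSuperiorTimes (interpolate (potential v))}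

end StickyParticles

namespace StickyParticles

/-! ### Finite sums -/

/-! Since order is preserved, `q` is the left endpoint of its ultimate clump iff `q - 1` and `q`
never meet. Everything rests on comparing the mean initial velocities of blocks `[i, q)` and `[q,
j)`, which are minus the slopes of the potential over `[i, q]` and `[q, j]`. If `q - 1` and `q`
meet, their clump is some `[i, j)`. By `barycentre`, the free barycentre of its left part has by
then caught up with that of its right part, so the left part was faster: `ψ` lies below a chord at
`q`. If they never meet, the free barycentre of every `[i, q)` stays behind that of every `[q, j)`;
letting `t → ∞` orders the mean velocities weakly, and genericity makes this strict. Finally, `q` is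
an extremal superior time iff every slope to its left strictly exceeds every slope to its right. -/

theorem sum_nonneg_of_fibers {ι : Type*} (J : Finset ι) (f g : ι → ℝ)
    (hf : ∀ i ∈ J, 0 ≤ ∑ l ∈ J with g l = g i, f l) : 0 ≤ ∑ l ∈ J, f l := by
  classical
  rw [← Finset.sum_fiberwise_of_maps_to (t := J.image g) (g := g)
    (fun i hi => Finset.mem_image_of_mem g hi)]
  refine Finset.sum_nonneg fun y hy => ?_
  obtain ⟨i, hi, rfl⟩ := Finset.mem_image.1 hy
  exact hf i hi

/-- The initial barycentre of `A` is to the left of that of `B`, with denominators cleared: sum `x b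
- x a ≥ 0` over all pairs. -/
theorem card_mul_sum_le (A B : Finset ℤ) (x : ℤ → ℝ) (hx : StrictMono x)
    (hAB : ∀ a ∈ A, ∀ b ∈ B, a < b) :
    (B.card : ℝ) * ∑ a ∈ A, x a ≤ A.card * ∑ b ∈ B, x b := by
  have h : 0 ≤ ∑ a ∈ A, ∑ b ∈ B, (x b - x a) :=
    Finset.sum_nonneg fun a ha => Finset.sum_nonneg fun b hb =>
      sub_nonneg.2 (hx (hAB a ha b hb)).le
  simp only [Finset.sum_sub_distrib, Finset.sum_const, nsmul_eq_mul] at h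
  rw [← Finset.mul_sum] at h
  linarith

theorem card_mul_sum_lt (A B : Finset ℤ) (x : ℤ → ℝ) (hx : StrictMono x)
    (hA : A.Nonempty) (hB : B.Nonempty) (hAB : ∀ a ∈ A, ∀ b ∈ B, a < b) :
    (B.card : ℝ) * ∑ a ∈ A, x a < A.card * ∑ b ∈ B, x b := by
  have h : 0 < ∑ a ∈ A, ∑ b ∈ B, (x b - x a) :=
    Finset.sum_pos (fun a ha => Finset.sum_pos (fun b hb =>
      sub_pos.2 (hx (hAB a ha b hb))) hB) hA
  simp only [Finset.sum_sub_distrib, Finset.sum_const, nsmul_eq_mul] at h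
  rw [← Finset.mul_sum] at h
  linarith

/-! ### Clumps of a sticky evolution -/

section Evolution

variable {x v : ℤ → ℝ} {X V : ℝ → ℤ → ℝ}

/-- Two particles cannot exchange order without meeting, by the intermediate value theorem, and
after meeting they coincide. -/
theorem IsStickyEvolution.monotone (h : IsStickyEvolution x v X V) (hx : StrictMono x)
    {t : ℝ} (ht : 0 ≤ t) : Monotone (X t) := by
  intro i j hij
  rcases hij.eq_or_lt with rfl | hij
  · exact le_rfl
  by_contra! hlt
  have hc : ContinuousOn (fun s => X s j - X s i) (Icc 0 t) :=
    ((h.continuousOn j).sub (h.continuousOn i)).mono Icc_subset_Ici_self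
  have h0 : (0 : ℝ) ∈ Icc (X t j - X t i) (X 0 j - X 0 i) := by
    rw [h.init_pos, h.init_pos]
    exact ⟨by linarith, by linarith [hx hij]⟩
  obtain ⟨s, hs, hs0⟩ := intermediate_value_Icc' ht hc h0
  have := h.sticky s t i j hs.1 hs.2 (by simp only at hs0; linarith)
  linarith

theorem IsStickyEvolution.clump_subset (h : IsStickyEvolution x v X V) {s t : ℝ} (hs : 0 ≤ s)
    (hst : s ≤ t) (k : ℤ) : clump X s k ⊆ clump X t k :=
  fun j hj => h.sticky s t j k hs hst hj

/-- The first time at which a clump is complete. -/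
theorem IsStickyEvolution.exists_formation_time (h : IsStickyEvolution x v X V) {t : ℝ}
    (ht : 0 ≤ t) (k : ℤ) : ∃ t₀, 0 ≤ t₀ ∧ t₀ ≤ t ∧ clump X t₀ k = clump X t k ∧
      ∀ s, 0 ≤ s → s < t₀ → clump X s k ≠ clump X t k := by
  set S : Set ℝ := Icc 0 t ∩ ⋂ j ∈ clump X t k, (Icc 0 t ∩ (fun s => X s j - X s k) ⁻¹' {0})
    with hS
  have hcl : IsClosed S := by
    refine isClosed_Icc.inter (isClosed_biInter fun j _ => ?_)
    exact (((h.continuousOn j).sub (h.continuousOn k)).mono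
      Icc_subset_Ici_self).preimage_isClosed_of_isClosed isClosed_Icc isClosed_singleton
  have hmem : ∀ s, s ∈ S ↔ (0 ≤ s ∧ s ≤ t) ∧ clump X s k = clump X t k := by
    intro s
    simp only [hS, mem_inter_iff, mem_iInter, mem_Icc, mem_preimage, mem_singleton_iff]
    constructor
    · rintro ⟨hs, hj⟩
      exact ⟨hs, (h.clump_subset hs.1 hs.2 k).antisymm fun j hjm =>
        sub_eq_zero.1 (hj j hjm).2⟩
    · rintro ⟨hs, he⟩
      refine ⟨hs, fun j hj => ⟨hs, sub_eq_zero.2 ?_⟩⟩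
      rw [← he] at hj
      exact hj
  have hcomp : IsCompact S := isCompact_Icc.of_isClosed_subset hcl inter_subset_left
  obtain ⟨t₀, h₀, hmin⟩ := hcomp.exists_isLeast ⟨t, (hmem t).2 ⟨⟨ht, le_rfl⟩, rfl⟩⟩
  obtain ⟨⟨h1, h2⟩, h3⟩ := (hmem t₀).1 h₀
  refine ⟨t₀, h1, h2, h3, fun s hs hst he => ?_⟩
  exact absurd (hmin ((hmem s).2 ⟨⟨hs, by linarith⟩, he⟩)) (not_le.2 hst)

/-- The members of a clump as a finite set. -/
noncomputable def IsStickyEvolution.members (h : IsStickyEvolution x v X V) {t : ℝ} (ht : 0 ≤ t)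
    (k : ℤ) : Finset ℤ := (h.clump_finite t k ht).toFinset

theorem IsStickyEvolution.mem_members (h : IsStickyEvolution x v X V) {t : ℝ} (ht : 0 ≤ t)
    {j k : ℤ} : j ∈ h.members ht k ↔ X t j = X t k := by
  simp [IsStickyEvolution.members, clump]

/-- A clump sits at its free barycentre, moves at its mean initial velocity, and the free
barycentre of every initial segment of it is not to its left. -/
theorem IsStickyEvolution.barycentre (h : IsStickyEvolution x v X V) (hx : StrictMono x)
    {t : ℝ} (ht : 0 ≤ t) (k : ℤ) :
    ∑ j ∈ h.members ht k, (x j + t * v j - X t k) = 0 ∧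
      ∑ j ∈ h.members ht k, (v j - V t k) = 0 ∧
      ∀ c : ℤ, 0 ≤ ∑ j ∈ h.members ht k with j < c, (x j + t * v j - X t k) := by
  -- Strong induction on the size of the clump: before its formation time it consists of strictly
  -- smaller clumps.
  induction hn : (h.members ht k).card using Nat.strong_induction_on generalizing t k with
  | _ n ih =>
  obtain ⟨t₀, ht₀, htt, hcl, hmin⟩ := h.exists_formation_time ht k
  have hI : h.members ht₀ k = h.members ht k := by
    ext j
    rw [h.mem_members, h.mem_members]
    exact Set.ext_iff.1 hcl j
  obtain ⟨hXt, hVt⟩ := h.free t₀ t k ht₀ htt hcl.symm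
  rcases ht₀.eq_or_lt with rfl | hpos
  · have hs : h.members ht k = {k} := by
      rw [← hI]
      ext j
      rw [h.mem_members, h.init_pos, h.init_pos, hx.injective.eq_iff, Finset.mem_singleton]
    rw [h.init_pos, h.init_vel] at hXt
    rw [h.init_vel] at hVt
    have hz : x k + t * v k - X t k = 0 := by rw [hXt]; ring
    refine ⟨by rw [hs, Finset.sum_singleton, hz], by rw [hs, Finset.sum_singleton, hVt, sub_self],
      fun c => Finset.sum_nonneg fun j hj => ?_⟩
    rw [hs] at hj
    obtain rfl := Finset.mem_singleton.1 (Finset.mem_filter.1 hj).1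
    exact hz.ge
  set I := h.members ht k with hIdef
  have hsub : ∀ s (hs : 0 ≤ s), s < t₀ → ∀ i ∈ I, I.filter (fun l => X s l = X s i) =
      h.members hs i ∧ (h.members hs i).card < n := by
    intro s hs hst i hi
    have hss : h.members hs i ⊂ I := by
      refine Finset.ssubset_iff_subset_ne.2 ⟨fun j hj => ?_, fun he => ?_⟩
      · rw [hIdef, h.mem_members] at hi ⊢
        rw [h.mem_members] at hj
        exact (h.sticky s t j i hs (by linarith) hj).trans hi
      · apply hmin s hs hst
        ext j
        have hk : k ∈ h.members hs i := by rw [he, hIdef, h.mem_members]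
        have hj : j ∈ h.members hs i ↔ j ∈ I := by rw [he]
        rw [hIdef, h.mem_members, h.mem_members] at hj
        rw [h.mem_members] at hk
        change X s j = X s k ↔ X t j = X t k
        rw [hk, hj]
    refine ⟨?_, hn ▸ Finset.card_lt_card hss⟩
    ext j
    rw [Finset.mem_filter]
    exact ⟨fun hj => (h.mem_members hs).2 hj.2, fun hj => ⟨hss.1 hj, (h.mem_members hs).1 hj⟩⟩
  -- The identities are proved for `s < t₀` by summing over subclumps, and pass to `t₀` by
  -- continuity.
  have hev : ∀ᶠ s in 𝓝[<] t₀, 0 < s ∧ s < t₀ := Ioo_mem_nhdsLT hpos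
  have hX₀ : ∀ j ∈ I, X t₀ j = X t₀ k := fun j hj => by
    rw [← hI, h.mem_members] at hj
    exact hj
  have htend : ∀ J ⊆ I, Tendsto (fun s => ∑ j ∈ J, (x j + s * v j - X s j)) (𝓝[<] t₀)
      (𝓝 (∑ j ∈ J, (x j + t₀ * v j - X t₀ k))) := by
    intro J hJ
    refine tendsto_finsetSum _ fun j hj => ?_
    rw [← hX₀ j (hJ hj)]
    have hc : Tendsto (fun s => X s j) (𝓝[<] t₀) (𝓝 (X t₀ j)) :=
      ((h.continuousOn j).continuousAt (Ici_mem_nhds hpos)).tendsto.mono_left nhdsWithin_le_nhds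
    have hid : Tendsto (fun s : ℝ => s) (𝓝[<] t₀) (𝓝 t₀) := nhdsWithin_le_nhds
    exact ((hid.mul_const _).const_add _).sub hc
  have hfib0 : ∀ s (hs : 0 ≤ s), s < t₀ → ∑ j ∈ I, (x j + s * v j - X s j) = 0 := by
    intro s hs hst
    rw [← Finset.sum_fiberwise_of_maps_to (t := I.image (X s)) (g := X s)
      (fun i hi => Finset.mem_image_of_mem _ hi)]
    refine Finset.sum_eq_zero fun y hy => ?_
    obtain ⟨i, hi, rfl⟩ := Finset.mem_image.1 hy
    obtain ⟨he, hc⟩ := hsub s hs hst i hi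
    rw [he, ← (ih _ hc hs i rfl).1]
    exact Finset.sum_congr rfl fun j hj => by rw [(h.mem_members hs).1 hj]
  have hfibv : ∀ s (hs : 0 ≤ s), s < t₀ → ∑ j ∈ I, (v j - V s j) = 0 := by
    intro s hs hst
    rw [← Finset.sum_fiberwise_of_maps_to (t := I.image (X s)) (g := X s)
      (fun i hi => Finset.mem_image_of_mem _ hi)]
    refine Finset.sum_eq_zero fun y hy => ?_
    obtain ⟨i, hi, rfl⟩ := Finset.mem_image.1 hy
    obtain ⟨he, hc⟩ := hsub s hs hst i hi
    rw [he]
    have hmem : ∀ j ∈ h.members hs i, h.members hs j = h.members hs i := fun j hj => by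
      ext l
      rw [h.mem_members, h.mem_members, (h.mem_members hs).1 hj]
    -- A common velocity within a clump is not postulated; it follows because the mean initial
    -- velocity determines `V`.
    have hconst : ∀ j ∈ h.members hs i, V s j = V s i := by
      intro j hj
      have h1 := (ih _ hc hs i rfl).2.1
      have h2 := (ih _ (by rw [hmem j hj]; exact hc) hs j rfl).2.1
      rw [hmem j hj] at h2
      simp only [Finset.sum_sub_distrib, Finset.sum_const, nsmul_eq_mul] at h1 h2
      have hcard : ((h.members hs i).card : ℝ) ≠ 0 := by
        exact_mod_cast (Finset.card_pos.2 ⟨j, hj⟩).ne'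
      exact mul_left_cancel₀ hcard (by linarith)
    rw [← (ih _ hc hs i rfl).2.1]
    exact Finset.sum_congr rfl fun j hj => by rw [hconst j hj]
  have hfibc : ∀ c : ℤ, ∀ s (hs : 0 ≤ s), s < t₀ →
      0 ≤ ∑ j ∈ I with j < c, (x j + s * v j - X s j) := by
    intro c s hs hst
    refine sum_nonneg_of_fibers _ _ (X s) fun i hi => ?_
    obtain ⟨he, hc⟩ := hsub s hs hst i (Finset.mem_filter.1 hi).1
    rw [Finset.filter_comm, he]
    refine ((ih _ hc hs i rfl).2.2 c).trans_eq ?_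
    exact Finset.sum_congr rfl fun j hj => by
      rw [(h.mem_members hs).1 (Finset.mem_filter.1 hj).1]
  have hpos0 : ∑ j ∈ I, (x j + t₀ * v j - X t₀ k) = 0 :=
    tendsto_nhds_unique (htend I subset_rfl) (tendsto_const_nhds.congr' (by
      filter_upwards [hev] with s hs
      exact (hfib0 s hs.1.le hs.2).symm))
  have hposc : ∀ c : ℤ, 0 ≤ ∑ j ∈ I with j < c, (x j + t₀ * v j - X t₀ k) := fun c =>
    ge_of_tendsto (htend _ (Finset.filter_subset _ _)) (by
      filter_upwards [hev] with s hs
      exact hfibc c s hs.1.le hs.2)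
  have hvel0 : ∑ j ∈ I, (v j - V t₀ k) = 0 := by
    obtain ⟨s, hm, hs⟩ := ((h.momentum t₀ k hpos).and hev).exists
    have hset : clump X t₀ k = (I : Set ℤ) := by
      ext j
      rw [Finset.mem_coe, ← hI, h.mem_members]
      rfl
    rw [hset, finsum_mem_coe_finset, Set.ncard_coe_finset] at hm
    have := hfibv s hs.1.le hs.2
    simp only [Finset.sum_sub_distrib, Finset.sum_const, nsmul_eq_mul] at this ⊢
    linarith
  have hpos1 : ∑ j ∈ I, (x j + t * v j - X t k) = 0 := by
    have : ∑ j ∈ I, (x j + t * v j - X t k) = ∑ j ∈ I, (x j + t₀ * v j - X t₀ k) +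
        (t - t₀) * ∑ j ∈ I, (v j - V t₀ k) := by
      rw [Finset.mul_sum, ← Finset.sum_add_distrib]
      exact Finset.sum_congr rfl fun j _ => by rw [hXt]; ring
    rw [this, hpos0, hvel0]
    ring
  refine ⟨hpos1, by rw [hVt]; exact hvel0, fun c => ?_⟩
  -- From `t₀` to `t`: the gap between the free barycentres of `A` and `B` is affine in time,
  -- nonpositive at `0` and nonnegative at `t₀ > 0`, so it is nondecreasing and still nonnegative at
  -- `t`.
  set A := I.filter (· < c) with hA
  set B := I.filter (fun j => ¬ j < c) with hB
  have hAB : ∀ a ∈ A, ∀ b ∈ B, a < b := fun a ha b hb => by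
    have h1 := (Finset.mem_filter.1 ha).2
    have h2 := (Finset.mem_filter.1 hb).2
    omega
  have h0 := card_mul_sum_le A B x hx hAB
  have hc0 := hposc c
  rw [← Finset.sum_filter_add_sum_filter_not I (· < c)] at hpos0 hpos1
  rw [← hA] at hc0
  rw [← hA, ← hB] at hpos0 hpos1
  simp only [Finset.sum_sub_distrib, Finset.sum_add_distrib, Finset.sum_const, nsmul_eq_mul,
    ← Finset.mul_sum] at hpos0 hpos1 hc0 ⊢
  rcases B.eq_empty_or_nonempty with hBe | hBne
  · simp only [hBe, Finset.sum_empty, Finset.card_empty, Nat.cast_zero] at hpos1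
    linarith
  have hb : (0 : ℝ) < B.card := by exact_mod_cast Finset.card_pos.2 hBne
  have ha : (0 : ℝ) ≤ A.card := Nat.cast_nonneg _
  generalize ∑ j ∈ A, x j = xA at *
  generalize ∑ j ∈ B, x j = xB at *
  generalize ∑ j ∈ A, v j = vA at *
  generalize ∑ j ∈ B, v j = vB at *
  generalize (A.card : ℝ) = a at *
  generalize (B.card : ℝ) = b at *
  have hk : 0 ≤ b * (xA + t₀ * vA) - a * (xB + t₀ * vB) := by
    have e : b * (xA + t₀ * vA) - a * (xB + t₀ * vB) =
      (a + b) * (xA + t₀ * vA - a * X t₀ k) := by linear_combination (-a) * hpos0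
    rw [e]
    positivity
  have hw : 0 ≤ b * vA - a * vB := by
    have : 0 ≤ t₀ * (b * vA - a * vB) := by linarith
    exact nonneg_of_mul_nonneg_right this hpos
  have hk1 : 0 ≤ (a + b) * (xA + t * vA - a * X t k) := by
    have e : (a + b) * (xA + t * vA - a * X t k) =
      (b * (xA + t₀ * vA) - a * (xB + t₀ * vB)) + (t - t₀) * (b * vA - a * vB) := by
        linear_combination a * hpos1
    rw [e]
    have := mul_nonneg (sub_nonneg.2 htt) hw
    linarith
  exact nonneg_of_mul_nonneg_right hk1 (by linarith)

/-- Inside a clump, the left part was faster on average than the right part. -/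
theorem IsStickyEvolution.exists_sum_vel_lt (h : IsStickyEvolution x v X V) (hx : StrictMono x)
    {t : ℝ} (ht : 0 ≤ t) {q : ℤ} (hq : X t (q - 1) = X t q) :
    ∃ i j : ℤ, i < q ∧ q < j ∧
      ((q : ℝ) - i) * ∑ l ∈ Finset.Ico q j, v l < ((j : ℝ) - q) * ∑ l ∈ Finset.Ico i q, v l := by
  obtain ⟨h1, -, h3⟩ := h.barycentre hx ht q
  have h3 := h3 q
  have hm := h.monotone hx ht
  set I := h.members ht q with hI
  have hne : I.Nonempty := ⟨q, (h.mem_members ht).2 rfl⟩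
  set i := I.min' hne
  set j := I.max' hne + 1 with hj
  -- By monotonicity the clump is an interval of integers.
  have hIeq : ∀ l, l ∈ I ↔ i ≤ l ∧ l < j := by
    intro l
    constructor
    · exact fun hl => ⟨I.min'_le l hl, by have := I.le_max' l hl; omega⟩
    · rintro ⟨hl1, hl2⟩
      have e1 := (h.mem_members ht).1 (I.min'_mem hne)
      have e2 := (h.mem_members ht).1 (I.max'_mem hne)
      refine (h.mem_members ht).2 (le_antisymm ?_ ?_)
      · exact (hm (by omega)).trans_eq e2
      · exact e1.symm.trans_le (hm hl1)
  have hiq : i < q := by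
    have := ((hIeq (q - 1)).1 ((h.mem_members ht).2 hq)).1
    omega
  have hqj : q < j := ((hIeq q).1 ((h.mem_members ht).2 rfl)).2
  have hA : I.filter (· < q) = Finset.Ico i q := by
    ext l
    rw [Finset.mem_filter, hIeq, Finset.mem_Ico]
    omega
  have hB : I.filter (fun l => ¬ l < q) = Finset.Ico q j := by
    ext l
    rw [Finset.mem_filter, hIeq, Finset.mem_Ico]
    omega
  refine ⟨i, j, hiq, hqj, ?_⟩
  have h0 := card_mul_sum_lt (Finset.Ico i q) (Finset.Ico q j) x hx
    (Finset.nonempty_Ico.2 hiq) (Finset.nonempty_Ico.2 hqj) (fun a ha b hb => by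
      have h1 := (Finset.mem_Ico.1 ha).2
      have h2 := (Finset.mem_Ico.1 hb).1
      omega)
  rw [← Finset.sum_filter_add_sum_filter_not I (· < q), hB] at h1
  rw [hA] at h1 h3
  have ca : ((Finset.Ico i q).card : ℝ) = q - i := by
    rw [Int.card_Ico, ← Int.cast_natCast, Int.toNat_of_nonneg (by omega), Int.cast_sub]
  have cb : ((Finset.Ico q j).card : ℝ) = j - q := by
    rw [Int.card_Ico, ← Int.cast_natCast, Int.toNat_of_nonneg (by omega), Int.cast_sub]
  simp only [Finset.sum_sub_distrib, Finset.sum_add_distrib, Finset.sum_const, nsmul_eq_mul,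
    ← Finset.mul_sum, ca, cb] at h0 h1 h3
  have hapos : (0 : ℝ) < q - i := by exact_mod_cast sub_pos.2 hiq
  have hbpos : (0 : ℝ) < j - q := by exact_mod_cast sub_pos.2 hqj
  generalize (q : ℝ) - i = a at *
  generalize (j : ℝ) - q = b at *
  generalize ∑ l ∈ Finset.Ico i q, x l = xA at *
  generalize ∑ l ∈ Finset.Ico q j, x l = xB at *
  generalize ∑ l ∈ Finset.Ico i q, v l = vA at *
  generalize ∑ l ∈ Finset.Ico q j, v l = vB at *
  have hk : 0 ≤ b * (xA + t * vA) - a * (xB + t * vB) := by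
    have e : b * (xA + t * vA) - a * (xB + t * vB) =
      (a + b) * (xA + t * vA - a * X t q) := by linear_combination (-a) * h1
    rw [e]
    positivity
  have : 0 < t * (b * vA - a * vB) := by linarith
  linarith [pos_of_mul_pos_right this ht]

/-- If `q - 1` and `q` never meet, the particles to the left of `q` are not faster on average than
those to the right. -/
theorem IsStickyEvolution.sum_vel_le (h : IsStickyEvolution x v X V) (hx : StrictMono x)
    {q : ℤ} (hq : ∀ t, 0 ≤ t → X t (q - 1) ≠ X t q) {i j : ℤ} (hi : i < q) (hj : q < j) :
    ((j : ℝ) - q) * ∑ l ∈ Finset.Ico i q, v l ≤ ((q : ℝ) - i) * ∑ l ∈ Finset.Ico q j, v l := by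
  have ca : ((Finset.Ico i q).card : ℝ) = q - i := by
    rw [Int.card_Ico, ← Int.cast_natCast, Int.toNat_of_nonneg (by omega), Int.cast_sub]
  have cb : ((Finset.Ico q j).card : ℝ) = j - q := by
    rw [Int.card_Ico, ← Int.cast_natCast, Int.toNat_of_nonneg (by omega), Int.cast_sub]
  have hapos : (0 : ℝ) < q - i := by exact_mod_cast sub_pos.2 hi
  have hbpos : (0 : ℝ) < j - q := by exact_mod_cast sub_pos.2 hj
  -- At every time `X t q` separates the free barycentres of the two blocks.
  have key : ∀ t, 0 ≤ t → ((j : ℝ) - q) * (∑ l ∈ Finset.Ico i q, x l +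
      t * ∑ l ∈ Finset.Ico i q, v l) ≤ ((q : ℝ) - i) * (∑ l ∈ Finset.Ico q j, x l +
      t * ∑ l ∈ Finset.Ico q j, v l) := by
    intro t ht
    have hm := h.monotone hx ht
    have hlt : X t (q - 1) < X t q := lt_of_le_of_ne (hm (by omega)) (hq t ht)
    -- No clump straddles `q`, so `[q, j)` splits into initial segments of clumps (all but the last
    -- one whole), and `barycentre` applies to each.
    have hR : 0 ≤ ∑ l ∈ Finset.Ico q j, (x l + t * v l - X t l) := by
      refine sum_nonneg_of_fibers _ _ (X t) fun p hp => ?_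
      have hqp := (Finset.mem_Ico.1 hp).1
      have he : (Finset.Ico q j).filter (fun l => X t l = X t p) =
          (h.members ht p).filter (· < j) := by
        ext l
        simp only [Finset.mem_filter, Finset.mem_Ico, h.mem_members]
        refine ⟨fun hl => ⟨hl.2, hl.1.2⟩, fun hl => ⟨⟨?_, hl.2⟩, hl.1⟩⟩
        by_contra! hlq
        have h1 : X t l ≤ X t (q - 1) := hm (by omega)
        have h2 : X t q ≤ X t p := hm hqp
        linarith [hl.1]
      rw [he]
      refine ((h.barycentre hx ht p).2.2 j).trans_eq ?_
      exact Finset.sum_congr rfl fun l hl => by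
        rw [(h.mem_members ht).1 (Finset.mem_filter.1 hl).1]
    -- Likewise `[i, q)` splits into final segments, which are complements of initial segments in
    -- clumps of total deviation zero.
    have hL : 0 ≤ ∑ l ∈ Finset.Ico i q, -(x l + t * v l - X t l) := by
      refine sum_nonneg_of_fibers _ _ (X t) fun p hp => ?_
      have hqp := (Finset.mem_Ico.1 hp).2
      have he : (Finset.Ico i q).filter (fun l => X t l = X t p) =
          (h.members ht p).filter (fun l => ¬ l < i) := by
        ext l
        simp only [Finset.mem_filter, Finset.mem_Ico, h.mem_members, not_lt]
        refine ⟨fun hl => ⟨hl.2, hl.1.1⟩, fun hl => ⟨⟨hl.2, ?_⟩, hl.1⟩⟩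
        by_contra! hlq
        have h1 : X t q ≤ X t l := hm hlq
        have h2 : X t p ≤ X t (q - 1) := hm (by omega)
        linarith [hl.1]
      obtain ⟨h1, -, h3⟩ := h.barycentre hx ht p
      have h3 := h3 i
      rw [← Finset.sum_filter_add_sum_filter_not _ (· < i)] at h1
      rw [he, Finset.sum_neg_distrib]
      have : ∑ l ∈ h.members ht p with ¬ l < i, (x l + t * v l - X t l) =
          ∑ l ∈ h.members ht p with ¬ l < i, (x l + t * v l - X t p) :=
        Finset.sum_congr rfl fun l hl => by
          rw [(h.mem_members ht).1 (Finset.mem_filter.1 hl).1]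
      linarith
    have hR' : ((j : ℝ) - q) * X t q ≤ ∑ l ∈ Finset.Ico q j, X t l := by
      rw [← cb, ← nsmul_eq_mul]
      exact Finset.card_nsmul_le_sum _ _ _ fun l hl => hm (Finset.mem_Ico.1 hl).1
    have hL' : ∑ l ∈ Finset.Ico i q, X t l ≤ ((q : ℝ) - i) * X t q := by
      rw [← ca, ← nsmul_eq_mul]
      exact Finset.sum_le_card_nsmul _ _ _ fun l hl => hm (Finset.mem_Ico.1 hl).2.le
    simp only [Finset.sum_neg_distrib, Finset.sum_sub_distrib, Finset.sum_add_distrib,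
      ← Finset.mul_sum] at hL hR
    calc _ ≤ ((j : ℝ) - q) * (((q : ℝ) - i) * X t q) :=
          mul_le_mul_of_nonneg_left (by linarith) hbpos.le
      _ = ((q : ℝ) - i) * (((j : ℝ) - q) * X t q) := by ring
      _ ≤ _ := mul_le_mul_of_nonneg_left (by linarith) hapos.le
  generalize (q : ℝ) - i = a at *
  generalize (j : ℝ) - q = b at *
  generalize ∑ l ∈ Finset.Ico i q, x l = xA at *
  generalize ∑ l ∈ Finset.Ico q j, x l = xB at *
  generalize ∑ l ∈ Finset.Ico i q, v l = vA at *
  generalize ∑ l ∈ Finset.Ico q j, v l = vB at *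
  by_contra! hlt
  have hd : 0 < b * vA - a * vB := sub_pos.2 hlt
  -- At this time the linear term of `key` exceeds its constant term by at least `1`.
  have := key ((|a * xB - b * xA| + 1) / (b * vA - a * vB)) (by positivity)
  have e : (|a * xB - b * xA| + 1) / (b * vA - a * vB) * (b * vA - a * vB) =
    |a * xB - b * xA| + 1 := div_mul_cancel₀ _ hd.ne'
  have := le_abs_self (a * xB - b * xA)
  nlinarith

end Evolution

/-! ### Extremal superior times -/

theorem potential_sub (v : ℤ → ℝ) {i j : ℤ} (hij : i ≤ j) :
    potential v j - potential v i = -∑ l ∈ Finset.Ico i j, v l := by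
  induction j, hij using Int.leInduction with
  | base => simp
  | succ j hj ih =>
    have h1 : Finset.Ico i (j + 1) = insert j (Finset.Ico i j) := by
      ext l; simp only [Finset.mem_Ico, Finset.mem_insert]; omega
    rw [h1, Finset.sum_insert (by simp)]
    linarith [potential_succ_sub v j]

theorem interpolate_intCast (ψ : ℤ → ℝ) (k : ℤ) : interpolate ψ k = ψ k := by
  simp [interpolate]

theorem graph_point_eq (ψ : ℤ → ℝ) (a : ℝ) :
    (a, interpolate ψ a) = (1 - Int.fract a) • (((⌊a⌋ : ℝ), ψ ⌊a⌋) : ℝ × ℝ) +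
      Int.fract a • ((((⌊a⌋ + 1 : ℤ) : ℝ), ψ (⌊a⌋ + 1)) : ℝ × ℝ) := by
  ext
  · simp only [Prod.fst_add, Prod.smul_fst, smul_eq_mul]
    push_cast
    linarith [Int.floor_add_fract a]
  · simp only [Prod.snd_add, Prod.smul_snd, smul_eq_mul, interpolate]
    ring

theorem intCast_mem_graph (ψ : ℤ → ℝ) (k : ℤ) :
    ((k : ℝ), ψ k) ∈ {p : ℝ × ℝ | p.2 = interpolate ψ p.1} :=
  (interpolate_intCast ψ k).symm

/-- Over a non-integer the graph point is interior to the segment joining its two integer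
neighbours. -/
theorem exists_int_of_mem_extremalSuperiorTimes (ψ : ℤ → ℝ) {a : ℝ}
    (ha : a ∈ extremalSuperiorTimes (interpolate ψ)) : ∃ q : ℤ, (q : ℝ) = a := by
  by_contra! hne
  have hf : 0 < Int.fract a := Int.fract_pos.2 (hne _).symm
  have hf1 := Int.fract_lt_one a
  have hseg : (a, interpolate ψ a) ∈ openSegment ℝ (((⌊a⌋ : ℝ), ψ ⌊a⌋) : ℝ × ℝ)
      ((((⌊a⌋ + 1 : ℤ) : ℝ), ψ (⌊a⌋ + 1)) : ℝ × ℝ) :=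
    ⟨1 - Int.fract a, Int.fract a, by linarith, hf, by ring, (graph_point_eq ψ a).symm⟩
  have := ha.1.2 (subset_convexHull ℝ _ (intCast_mem_graph ψ _))
    (subset_convexHull ℝ _ (intCast_mem_graph ψ _)) hseg
  exact hne ⌊a⌋ (congrArg Prod.fst this)

theorem slope_lt_of_mem_extremalSuperiorTimes (ψ : ℤ → ℝ) {q : ℤ}
    (hq : (q : ℝ) ∈ extremalSuperiorTimes (interpolate ψ)) {i j : ℤ} (hi : i < q) (hj : q < j) :
    (ψ j - ψ q) * ((q : ℝ) - i) < (ψ q - ψ i) * ((j : ℝ) - q) := by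
  have hapos : (0 : ℝ) < q - i := by exact_mod_cast sub_pos.2 hi
  have hbpos : (0 : ℝ) < j - q := by exact_mod_cast sub_pos.2 hj
  have hs : (0 : ℝ) < j - i := by linarith
  by_contra! hle
  have hmi := subset_convexHull ℝ _ (intCast_mem_graph ψ i)
  have hmj := subset_convexHull ℝ _ (intCast_mem_graph ψ j)
  set y := ((j : ℝ) - q) / (j - i) * ψ i + ((q : ℝ) - i) / (j - i) * ψ j with hy
  have hsum : ((j : ℝ) - q) / (j - i) + ((q : ℝ) - i) / (j - i) = 1 := by field_simp; ring
  have hseg : ((q : ℝ), y) ∈ openSegment ℝ (((i : ℝ), ψ i) : ℝ × ℝ) ((j : ℝ), ψ j) := by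
    refine ⟨((j : ℝ) - q) / (j - i), ((q : ℝ) - i) / (j - i), by positivity, by positivity,
      hsum, ?_⟩
    ext
    · simp only [Prod.fst_add, Prod.smul_fst, smul_eq_mul]
      field_simp
      ring
    · simp [hy]
  have hyle := hq.2 y ((convex_convexHull ℝ _).openSegment_subset hmi hmj hseg)
  -- The chord from `i` to `j` passes on or above the point, and the upper border forbids above; so
  -- it passes through the point, contradicting extremality.
  have hyq : y = interpolate ψ q := by
    refine le_antisymm hyle ?_
    rw [interpolate_intCast, hy, div_mul_eq_mul_div, div_mul_eq_mul_div, ← add_div,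
      le_div_iff₀ hs]
    linarith
  rw [hyq] at hseg
  have := congrArg Prod.fst (hq.1.2 hmi hmj hseg)
  simp only [Int.cast_inj] at this
  omega

/-- A point of the graph that is the last one, in one of the two directions, on a line above the
graph is an extremal superior time. -/
theorem mem_extremalSuperiorTimes_of_line (ψ : ℤ → ℝ) (q : ℤ) (m σ : ℝ) (hσ : σ ≠ 0)
    (hle : ∀ j, ψ j ≤ ψ q + m * (j - q))
    (heq : ∀ j : ℤ, ψ j = ψ q + m * (j - q) → σ * ((j : ℝ) - q) ≤ 0) :
    (q : ℝ) ∈ extremalSuperiorTimes (interpolate ψ) := by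
  -- The open half-plane below the line, together with the closed half-line of it that ends at `q`;
  -- the sign of `σ` selects which half. This set is convex, contains the graph, and has `(q, ψ q)`
  -- as an extreme point.
  set K : Set (ℝ × ℝ) := {p | p.2 - ψ q - m * (p.1 - q) ≤ 0 ∧
    (p.2 - ψ q - m * (p.1 - q) = 0 → σ * (p.1 - q) ≤ 0)} with hK
  have hconv : Convex ℝ K := by
    rintro ⟨x₁, y₁⟩ ⟨h₁, h₁'⟩ ⟨x₂, y₂⟩ ⟨h₂, h₂'⟩ a b ha hb hab
    simp only at h₁ h₁' h₂ h₂'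
    simp only [hK, mem_ofPred_eq, smul_eq_mul, Prod.smul_mk, Prod.mk_add_mk]
    have e : a * y₁ + b * y₂ - ψ q - m * (a * x₁ + b * x₂ - q) =
        a * (y₁ - ψ q - m * (x₁ - q)) + b * (y₂ - ψ q - m * (x₂ - q)) := by
      linear_combination (ψ q - m * q) * hab
    have n₁ := mul_nonpos_of_nonneg_of_nonpos ha h₁
    have n₂ := mul_nonpos_of_nonneg_of_nonpos hb h₂
    rw [e]
    refine ⟨by linarith, fun h0 => ?_⟩
    have e' : σ * (a * x₁ + b * x₂ - q) = a * (σ * (x₁ - q)) + b * (σ * (x₂ - q)) := by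
      linear_combination σ * q * hab
    rw [e']
    have z₁ : a * (σ * (x₁ - q)) ≤ 0 := by
      rcases mul_eq_zero.1 (le_antisymm n₁ (by linarith)) with h | h
      · rw [h, zero_mul]
      · exact mul_nonpos_of_nonneg_of_nonpos ha (h₁' h)
    have z₂ : b * (σ * (x₂ - q)) ≤ 0 := by
      rcases mul_eq_zero.1 (le_antisymm n₂ (by linarith)) with h | h
      · rw [h, zero_mul]
      · exact mul_nonpos_of_nonneg_of_nonpos hb (h₂' h)
    linarith
  have hint : ∀ j : ℤ, ((j : ℝ), ψ j) ∈ K := fun j =>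
    ⟨by simp only; linarith [hle j], fun h0 => heq j (by simp only at h0; linarith)⟩
  have hsub : convexHull ℝ {p : ℝ × ℝ | p.2 = interpolate ψ p.1} ⊆ K := by
    refine convexHull_min ?_ hconv
    rintro ⟨a, y⟩ hy
    obtain rfl : y = interpolate ψ a := hy
    rw [graph_point_eq]
    exact hconv (hint _) (hint _) (by linarith [Int.fract_lt_one a]) (Int.fract_nonneg a)
      (by ring)
  refine ⟨⟨subset_convexHull ℝ _ rfl, ?_⟩, fun y hy => ?_⟩
  · rintro ⟨x₁, y₁⟩ h₁ ⟨x₂, y₂⟩ h₂ ⟨a, b, ha, hb, hab, he⟩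
    obtain ⟨g₁, g₁'⟩ := hsub h₁
    obtain ⟨g₂, g₂'⟩ := hsub h₂
    simp only at g₁ g₁' g₂ g₂'
    rw [interpolate_intCast] at he ⊢
    have ex : a * x₁ + b * x₂ = q := by simpa using congrArg Prod.fst he
    have ey : a * y₁ + b * y₂ = ψ q := by simpa using congrArg Prod.snd he
    have n₁ := mul_nonpos_of_nonneg_of_nonpos ha.le g₁
    have n₂ := mul_nonpos_of_nonneg_of_nonpos hb.le g₂
    have e : a * (y₁ - ψ q - m * (x₁ - q)) + b * (y₂ - ψ q - m * (x₂ - q)) = 0 := by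
      linear_combination ey - m * ex + (-ψ q + m * q) * hab
    have z₁ : y₁ - ψ q - m * (x₁ - q) = 0 :=
      (mul_eq_zero.1 (le_antisymm n₁ (by linarith))).resolve_left ha.ne'
    have z₂ : y₂ - ψ q - m * (x₂ - q) = 0 :=
      (mul_eq_zero.1 (le_antisymm n₂ (by linarith))).resolve_left hb.ne'
    have m₁ := mul_nonpos_of_nonneg_of_nonpos ha.le (g₁' z₁)
    have m₂ := mul_nonpos_of_nonneg_of_nonpos hb.le (g₂' z₂)
    have e' : a * (σ * (x₁ - q)) + b * (σ * (x₂ - q)) = 0 := by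
      linear_combination σ * ex - σ * q * hab
    have w : x₁ - q = 0 :=
      (mul_eq_zero.1 ((mul_eq_zero.1 (le_antisymm m₁ (by linarith))).resolve_left
        ha.ne')).resolve_left hσ
    rw [w] at z₁
    ext
    · simp only; linarith
    · simp only; linarith
  · have := (hsub hy).1
    simp only [sub_self, mul_zero] at this
    rw [interpolate_intCast]
    linarith

theorem mem_extremalSuperiorTimes_of_slope_lt (ψ : ℤ → ℝ) (q : ℤ)
    (h : ∀ i j : ℤ, i < q → q < j →
      (ψ j - ψ q) * ((q : ℝ) - i) < (ψ q - ψ i) * ((j : ℝ) - q)) :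
    (q : ℝ) ∈ extremalSuperiorTimes (interpolate ψ) := by
  have hslope : ∀ i j : ℤ, i < q → q < j →
      (ψ j - ψ q) / ((j : ℝ) - q) < (ψ q - ψ i) / ((q : ℝ) - i) := by
    intro i j hi hj
    rw [div_lt_div_iff₀ (by exact_mod_cast sub_pos.2 hj) (by exact_mod_cast sub_pos.2 hi)]
    exact h i j hi hj
  -- The supporting line gets the supremum of the right slopes as its slope; this is at most every
  -- left slope.
  set S : Set ℝ := (fun j : ℤ => (ψ j - ψ q) / ((j : ℝ) - q)) '' Ioi q
  have hSne : S.Nonempty := ⟨_, q + 1, by simp, rfl⟩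
  have hSub : ∀ i < q, ∀ s ∈ S, s ≤ (ψ q - ψ i) / ((q : ℝ) - i) := by
    rintro i hi _ ⟨j, hj, rfl⟩
    exact (hslope i j hi hj).le
  have hbdd : BddAbove S := ⟨_, hSub (q - 1) (by omega)⟩
  set m := sSup S
  have hR : ∀ j : ℤ, q < j → (ψ j - ψ q) / ((j : ℝ) - q) ≤ m := fun j hj =>
    le_csSup hbdd ⟨j, hj, rfl⟩
  have hL : ∀ i : ℤ, i < q → m ≤ (ψ q - ψ i) / ((q : ℝ) - i) := fun i hi =>
    csSup_le hSne (hSub i hi)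
  have hle : ∀ j : ℤ, ψ j ≤ ψ q + m * (j - q) := by
    intro j
    rcases lt_trichotomy j q with hj | rfl | hj
    · have := hL j hj
      rw [le_div_iff₀ (by exact_mod_cast sub_pos.2 hj)] at this
      linarith
    · simp
    · have := hR j hj
      rw [div_le_iff₀ (by exact_mod_cast sub_pos.2 hj)] at this
      linarith
  -- By strictness, `m` cannot be both a right slope and a left slope, so on one side the line
  -- touches the integer points only at `q`.
  by_cases hatt : ∃ j : ℤ, q < j ∧ (ψ j - ψ q) / ((j : ℝ) - q) = m
  · obtain ⟨j, hj, hjm⟩ := hatt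
    refine mem_extremalSuperiorTimes_of_line ψ q m (-1) (by norm_num) hle fun i hi => ?_
    have hqi : q ≤ i := by
      by_contra! hlt
      have hp : (0 : ℝ) < q - i := by exact_mod_cast sub_pos.2 hlt
      have := hslope i j hlt hj
      rw [hjm, lt_div_iff₀ hp] at this
      linarith
    have : (q : ℝ) ≤ i := by exact_mod_cast hqi
    linarith
  · push Not at hatt
    refine mem_extremalSuperiorTimes_of_line ψ q m 1 one_ne_zero hle fun j hj => ?_
    have hqj : j ≤ q := by
      by_contra! hlt
      have hp : (0 : ℝ) < j - q := by exact_mod_cast sub_pos.2 hlt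
      refine hatt j hlt ?_
      rw [div_eq_iff hp.ne']
      linarith
    have : (j : ℝ) ≤ q := by exact_mod_cast hqj
    linarith

/-- The bridge between geometry and dynamics. Genericity serves only to exclude equal slopes in the
direction from no collision to extremality. -/
theorem IsStickyEvolution.mem_extremalIndices_iff {x v : ℤ → ℝ} {X V : ℝ → ℤ → ℝ}
    (h : IsStickyEvolution x v X V) (hx : StrictMono x)
    (hgen : ∀ k p r : ℤ, k < p → p < r →
      (potential v p - potential v k) / ((p : ℝ) - k) ≠
        (potential v r - potential v p) / ((r : ℝ) - p)) (q : ℤ) :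
    q ∈ extremalIndices v ↔ ∀ t, 0 ≤ t → X t (q - 1) ≠ X t q := by
  constructor
  · intro hq t ht he
    obtain ⟨i, j, hi, hj, hlt⟩ := h.exists_sum_vel_lt hx ht he
    have := slope_lt_of_mem_extremalSuperiorTimes _ hq hi hj
    rw [potential_sub v hi.le, potential_sub v hj.le] at this
    linarith
  · intro hq
    refine mem_extremalSuperiorTimes_of_slope_lt _ q fun i j hi hj => ?_
    have hapos : (0 : ℝ) < q - i := by exact_mod_cast sub_pos.2 hi
    have hbpos : (0 : ℝ) < j - q := by exact_mod_cast sub_pos.2 hj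
    have hle := h.sum_vel_le hx hq hi hj
    have hne := hgen i q j hi hj
    rw [Ne, div_eq_div_iff hapos.ne' hbpos.ne'] at hne
    refine lt_of_le_of_ne ?_ (Ne.symm hne)
    rw [potential_sub v hi.le, potential_sub v hj.le]
    linarith

/-! ### Ultimate clumps -/

section UltimateClump

variable {x v : ℤ → ℝ} {X V : ℝ → ℤ → ℝ}

theorem mem_ultimateClump_self (X : ℝ → ℤ → ℝ) (q : ℤ) : q ∈ ultimateClump X q :=
  ⟨0, le_rfl, rfl⟩

theorem mem_ultimateClump_symm {j k : ℤ} (hj : j ∈ ultimateClump X k) :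
    k ∈ ultimateClump X j :=
  let ⟨t, ht, he⟩ := hj
  ⟨t, ht, he.symm⟩

theorem IsStickyEvolution.mem_ultimateClump_trans (h : IsStickyEvolution x v X V) {i j k : ℤ}
    (hi : i ∈ ultimateClump X j) (hj : j ∈ ultimateClump X k) : i ∈ ultimateClump X k := by
  obtain ⟨s, hs, hi⟩ := hi
  obtain ⟨t, ht, hj⟩ := hj
  exact ⟨max s t, hs.trans (le_max_left _ _),
    (h.sticky s _ i j hs (le_max_left _ _) hi).trans (h.sticky t _ j k ht (le_max_right _ _) hj)⟩

theorem IsStickyEvolution.ultimateClump_eq (h : IsStickyEvolution x v X V) {j k : ℤ}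
    (hj : j ∈ ultimateClump X k) : ultimateClump X j = ultimateClump X k :=
  Subset.antisymm (fun _ hi => h.mem_ultimateClump_trans hi hj)
    fun _ hi => h.mem_ultimateClump_trans hi (mem_ultimateClump_symm hj)

theorem IsStickyEvolution.mem_ultimateClump_of_between (h : IsStickyEvolution x v X V)
    (hx : StrictMono x) {i j k : ℤ} (hij : i ≤ j) (hjk : j ≤ k) (hi : i ∈ ultimateClump X k) :
    j ∈ ultimateClump X k := by
  obtain ⟨t, ht, he⟩ := hi
  have he : X t i = X t k := he
  have hm := h.monotone hx ht
  exact ⟨t, ht, le_antisymm (hm hjk) (he.symm.trans_le (hm hij))⟩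

theorem IsStickyEvolution.isLeast_ultimateClump_iff (h : IsStickyEvolution x v X V)
    (hx : StrictMono x) (q : ℤ) :
    IsLeast (ultimateClump X q) q ↔ ∀ t, 0 ≤ t → X t (q - 1) ≠ X t q := by
  constructor
  · intro hq t ht he
    have := hq.2 ⟨t, ht, he⟩
    omega
  · refine fun hq => ⟨mem_ultimateClump_self X q, fun j hj => ?_⟩
    by_contra! hlt
    obtain ⟨t, ht, he⟩ := h.mem_ultimateClump_of_between hx (j := q - 1) (by omega) (by omega) hj
    exact hq t ht he

theorem IsStickyEvolution.isPartition_ultimateClump (h : IsStickyEvolution x v X V) :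
    Setoid.IsPartition (Set.range (ultimateClump X)) := by
  refine ⟨?_, fun k => ⟨ultimateClump X k, ⟨⟨k, rfl⟩, mem_ultimateClump_self X k⟩, ?_⟩⟩
  · rintro ⟨q, hq⟩
    exact (hq ▸ mem_ultimateClump_self X q : q ∈ (∅ : Set ℤ))
  · rintro _ ⟨⟨q, rfl⟩, hk⟩
    exact (h.ultimateClump_eq hk).symm

theorem IsStickyEvolution.mem_ultimateClump_of_forall_meet (h : IsStickyEvolution x v X V)
    {j k : ℤ} (hjk : j ≤ k)
    (hmeet : ∀ p, j < p → p ≤ k → ∃ t, 0 ≤ t ∧ X t (p - 1) = X t p) :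
    j ∈ ultimateClump X k := by
  induction k, hjk using Int.leInduction with
  | base => exact mem_ultimateClump_self X j
  | succ k hk ih =>
    refine h.mem_ultimateClump_trans (ih fun p hp hpk => hmeet p hp (by omega)) ?_
    obtain ⟨t, ht, he⟩ := hmeet (k + 1) (by omega) le_rfl
    exact ⟨t, ht, by rwa [add_sub_cancel_right] at he⟩

theorem IsStickyEvolution.iUnion_ultimateClump (h : IsStickyEvolution x v X V)
    (hx : StrictMono x) {E : Set ℤ} (hE : ∀ q, q ∈ E ↔ IsLeast (ultimateClump X q) q) :
    (⋃ q ∈ E, ultimateClump X q) = {k | ∃ q ∈ E, q ≤ k} := by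
  ext k
  simp only [mem_iUnion, exists_prop, mem_ofPred_eq]
  constructor
  · rintro ⟨q, hq, hk⟩
    exact ⟨q, hq, ((hE q).1 hq).2 hk⟩
  · rintro ⟨q, hq, hqk⟩
    -- Otherwise the clump of `k` would contain `q` together with an element below `q`, although `q`
    -- is least in its own clump.
    have hb : ∀ j, j ∈ ultimateClump X k → q ≤ j := by
      intro j hj
      by_contra! hlt
      have hqm := h.mem_ultimateClump_of_between hx hlt.le hqk hj
      rw [← h.ultimateClump_eq hqm] at hj
      exact absurd (((hE q).1 hq).2 hj) (not_le.2 hlt)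
    obtain ⟨m, hm, hmin⟩ := Int.exists_least_of_bdd ⟨q, hb⟩ ⟨k, mem_ultimateClump_self X k⟩
    refine ⟨m, (hE m).2 ⟨mem_ultimateClump_self X m, fun j hj => hmin j ?_⟩,
      mem_ultimateClump_symm hm⟩
    rwa [h.ultimateClump_eq hm] at hj

end UltimateClump

end StickyParticles

/-! ### The almost sure statement -/

theorem mainTheorem5 {Ω : Type*} [MeasurableSpace Ω] (P : Measure Ω) [IsProbabilityMeasure P]
    (x : ℤ → ℝ) (hx : StrictMono x) (hx_lim : Tendsto (fun k => |x k|) cofinite atTop)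
    (v : ℤ → Ω → ℝ) (hv : ∀ k, Measurable (v k))
    (hgen : ∀ k p r : ℤ, k < p → p < r → ∀ᵐ ω ∂P,
      (StickyParticles.potential (fun i => v i ω) p - StickyParticles.potential (fun i => v i ω) k)
          / ((p : ℝ) - k) ≠
        (StickyParticles.potential (fun i => v i ω) r
          - StickyParticles.potential (fun i => v i ω) p) / ((r : ℝ) - p)) :
    ∀ᵐ ω ∂P, ∀ X V : ℝ → ℤ → ℝ,
      StickyParticles.IsStickyEvolution x (fun k => v k ω) X V →
      ∀ E : Set ℤ, E = StickyParticles.extremalIndices (fun k => v k ω) →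
        -- the extremal superior times are integers
        (∀ a ∈ StickyParticles.extremalSuperiorTimes
            (StickyParticles.interpolate (StickyParticles.potential (fun k => v k ω))),
          ∃ q ∈ E, (q : ℝ) = a) ∧
        -- they are exactly the left endpoints of the ultimate clumps
        (∀ q, q ∈ E ↔ IsLeast (StickyParticles.ultimateClump X q) q) ∧
        -- the ultimate clumps partition the integers
        Setoid.IsPartition (Set.range (StickyParticles.ultimateClump X)) ∧
        -- distinct extremal superior times index disjoint blocks
        E.PairwiseDisjoint (StickyParticles.ultimateClump X) ∧
        -- these blocks cover every integer that is not to the left of all of `E`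
        (⋃ q ∈ E, StickyParticles.ultimateClump X q) = {k | ∃ q ∈ E, q ≤ k} ∧
        ((⋃ q ∈ E, StickyParticles.ultimateClump X q) = Set.univ ↔ ¬ BddBelow E) ∧
        -- the integers to the left of all of `E`, if any, form one further ultimate clump
        (∀ k, (∀ q ∈ E, k < q) →
          StickyParticles.ultimateClump X k = {j | ∀ q ∈ E, j < q}) ∧
        -- particles without collision
        (∀ k, StickyParticles.NeverCollides X k ↔ k ∈ E ∧ k + 1 ∈ E) := by
  -- There are countably many triples, so one null set serves them all; the rest is deterministic.
  have hall : ∀ᵐ ω ∂P, ∀ k p r : ℤ, k < p → p < r →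
      (StickyParticles.potential (fun i => v i ω) p - StickyParticles.potential (fun i => v i ω) k)
          / ((p : ℝ) - k) ≠
        (StickyParticles.potential (fun i => v i ω) r
          - StickyParticles.potential (fun i => v i ω) p) / ((r : ℝ) - p) := by
    simp only [ae_all_iff]
    exact hgen
  filter_upwards [hall] with ω hω X V h E hE
  have hmem : ∀ q, q ∈ E ↔ ∀ t, 0 ≤ t → X t (q - 1) ≠ X t q := by
    intro q
    rw [hE]
    exact h.mem_extremalIndices_iff hx hω q
  have hleast : ∀ q, q ∈ E ↔ IsLeast (StickyParticles.ultimateClump X q) q := by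
    intro q
    rw [hmem, h.isLeast_ultimateClump_iff hx]
  have hU := h.iUnion_ultimateClump hx hleast
  refine ⟨?_, hleast, h.isPartition_ultimateClump, ?_, hU, ?_, ?_, ?_⟩
  · intro a ha
    obtain ⟨q, rfl⟩ := StickyParticles.exists_int_of_mem_extremalSuperiorTimes _ ha
    exact ⟨q, by rw [hE]; exact ha, rfl⟩
  · intro q hq q' hq' hne
    refine Set.disjoint_left.2 fun j hj hj' => hne ?_
    have he := (h.ultimateClump_eq hj).symm.trans (h.ultimateClump_eq hj')
    have h1 := (hleast q).1 hq
    rw [he] at h1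
    exact h1.unique ((hleast q').1 hq')
  · rw [hU]
    constructor
    · rintro he ⟨b, hb⟩
      obtain ⟨q, hq, hqb⟩ := (Set.ext_iff.1 he (b - 1)).2 (Set.mem_univ _)
      have := hb hq
      omega
    · intro hb
      refine Set.eq_univ_of_forall fun k => ?_
      obtain ⟨q, hq, hqk⟩ := not_bddBelow_iff.1 hb k
      exact ⟨q, hq, hqk.le⟩
  · intro k hk
    ext j
    constructor
    · intro hj q hq
      by_contra! hqj
      have hjU : j ∈ ⋃ q ∈ E, StickyParticles.ultimateClump X q := by
        rw [hU]
        exact ⟨q, hq, hqj⟩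
      simp only [Set.mem_iUnion, exists_prop] at hjU
      obtain ⟨q', hq', hj'⟩ := hjU
      have hkq : k ∈ StickyParticles.ultimateClump X q' :=
        h.mem_ultimateClump_trans (StickyParticles.mem_ultimateClump_symm hj) hj'
      exact absurd (((hleast q').1 hq').2 hkq) (not_le.2 (hk q' hq'))
    · intro hj
      -- An integer to the left of all of `E` is not in `E`, hence meets its left neighbour;
      -- chaining such meetings links any two of these integers.
      have hmeet : ∀ m : ℤ, (∀ q ∈ E, m < q) → ∀ p, p ≤ m → ∃ t, 0 ≤ t ∧ X t (p - 1) = X t p := by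
        intro m hm p hp
        by_contra! hno
        exact absurd (hm p ((hmem p).2 hno)) (not_lt.2 hp)
      rcases le_total j k with hjk | hjk
      · exact h.mem_ultimateClump_of_forall_meet hjk fun p _ hp => hmeet k hk p hp
      · exact StickyParticles.mem_ultimateClump_symm
          (h.mem_ultimateClump_of_forall_meet hjk fun p _ hp => hmeet j hj p hp)
  · intro k
    rw [hmem, hmem, add_sub_cancel_right]
    exact ⟨fun hn => ⟨fun t ht => (hn t ht).1.symm, fun t ht => (hn t ht).2⟩,
      fun hn t ht => ⟨(hn.1 t ht).symm, hn.2 t ht⟩⟩
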